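/- Let $X$ be a connected cubic arc-transitive multigraph, that is, a non-empty connected multigraph (with vertex set finite or infinite, parallel edges allowed) in which every vertex has degree $3$ (loops being counted twice), and whose automorphism group acts transitively on arcs. Here an automorphism consists of a permutation of the vertices and a permutation of the edges that together preserve incidence, and an arc is an edge together with a direction from one of its ends to the other. The girth $g(X)$ is the length of a shortest cycle of $X$, where two parallel edges form a cycle of length $2$ and a loop is a cycle of length $1$; it is $\infty$ if $X$ has no cycle. Then one of the following occurs: (i) $g(X)\ge 6$; or (ii) $X$ is isomorphic to one of the following six graphs: the theta graph $\Theta_2$ (two vertices joined by three parallel edges), the complete graph $K_4$, the complete bipartite graph $K_{3,3}$, the cube $Q_3$, the Petersen graph $GP(5,2)$, or the dodecahedron graph $GP(10,2)$. Here $GP(n,k)$ is the generalized Petersen graph with vertices $u_i, w_i$ $(i\in\mathbb Z/n\mathbb Z)$ and edges $u_iu_{i+1}$, $u_iw_i$, $w_iw_{i+k}$. -/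

import Mathlib

open scoped Graph

namespace Graph

/-- An isomorphism of multigraphs: a bijection between the vertex sets together with a bijection
between the edge sets that preserve and reflect incidence. -/
structure Iso {α β α' β' : Type*} (G : Graph α β) (H : Graph α' β') where
  /-- the bijection of vertices -/
  vertexEquiv : V(G) ≃ V(H)
  /-- the bijection of edges -/
  edgeEquiv : E(G) ≃ E(H)
  isLink_iff : ∀ (e : E(G)) (x y : V(G)),
    H.IsLink (edgeEquiv e) (vertexEquiv x) (vertexEquiv y) ↔ G.IsLink e x y

/-- Two multigraphs are isomorphic. -/
def IsIsomorphic {α β α' β' : Type*} (G : Graph α β) (H : Graph α' β') : Prop :=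
  Nonempty (Graph.Iso G H)

/-- A multigraph is connected: it has a vertex, and any two vertices are joined by a walk. -/
def IsConnected {α β : Type*} (G : Graph α β) : Prop :=
  V(G).Nonempty ∧ ∀ x ∈ V(G), ∀ y ∈ V(G), Relation.ReflTransGen G.Adj x y

/-- The degree (valency) of a vertex: the number of incident edges, loops being counted twice. -/
noncomputable def vertexDegree {α β : Type*} (G : Graph α β) (x : α) : ℕ∞ :=
  (G.incidenceSet x).encard + (G.loopSet x).encard

/-- A multigraph is cubic if all its vertices have degree `3`. -/
def IsCubic {α β : Type*} (G : Graph α β) : Prop :=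
  ∀ x ∈ V(G), G.vertexDegree x = 3

/-- An arc is an edge `e` with a direction, from an end `x` of `e` to the other end `y`.
A multigraph is arc-transitive if its automorphisms act transitively on its arcs. -/
def IsArcTransitive {α β : Type*} (G : Graph α β) : Prop :=
  ∀ ⦃e : β⦄ ⦃x y : α⦄ (h : G.IsLink e x y) ⦃e' : β⦄ ⦃x' y' : α⦄ (h' : G.IsLink e' x' y'),
    ∃ φ : Graph.Iso G G,
      φ.edgeEquiv ⟨e, h.edge_mem⟩ = ⟨e', h'.edge_mem⟩ ∧
      φ.vertexEquiv ⟨x, h.left_mem⟩ = ⟨x', h'.left_mem⟩ ∧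
      φ.vertexEquiv ⟨y, h.right_mem⟩ = ⟨y', h'.right_mem⟩

/-- `G` has a cycle of length `n ≥ 1`: a closed walk `v 0, e 0, v 1, …, e (n - 1), v n = v 0`
whose vertices `v 0, …, v (n - 1)` are distinct and whose edges `e 0, …, e (n - 1)` are distinct.
So a loop is a cycle of length `1`, and two parallel edges form a cycle of length `2`. -/
def HasCycleOfLength {α β : Type*} (G : Graph α β) (n : ℕ) : Prop :=
  1 ≤ n ∧ ∃ (v : ℕ → α) (e : ℕ → β),
    (∀ i < n, G.IsLink (e i) (v i) (v (i + 1))) ∧ v n = v 0 ∧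
    Set.InjOn v (Set.Iio n) ∧ Set.InjOn e (Set.Iio n)

/-- The girth of a multigraph: the length of a shortest cycle, and `⊤` if there is no cycle. -/
noncomputable def girth {α β : Type*} (G : Graph α β) : ℕ∞ :=
  ⨅ (n : ℕ) (_ : G.HasCycleOfLength n), (n : ℕ∞)

/-- The theta graph: two vertices joined by three parallel edges. -/
def theta : Graph (Fin 2) (Fin 3) := Graph.banana 0 1 Set.univ

end Graph

/-- The cube `Q₃`: vertices are the 0-1-words of length three, adjacent when they differ in exactly
one position. -/
def cubeGraph : SimpleGraph (Fin 3 → Bool) :=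
  SimpleGraph.fromRel fun x y => hammingDist x y = 1

/-- The generalized Petersen graph `GP(n, k)`: outer vertices `u i = inl i` and inner vertices
`w i = inr i` for `i` in `ℤ/nℤ`, with edges `u i — u (i + 1)`, `u i — w i` and `w i — w (i + k)`. -/
def generalizedPetersen (n k : ℕ) : SimpleGraph (ZMod n ⊕ ZMod n) :=
  SimpleGraph.fromRel fun a b =>
    match a, b with
    | Sum.inl i, Sum.inl j => j = i + 1
    | Sum.inl i, Sum.inr j => j = i
    | Sum.inr _, Sum.inl _ => False
    | Sum.inr i, Sum.inr j => j = i + (k : ZMod n)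

/-! In degree `3`, a 2-path is determined, up to reversal, by its midpoint and the remaining
neighbour of that midpoint, that is, by an arc. Arc-transitivity therefore acts transitively on
2-paths up to reversal (`forall_twoPath`): if one 2-path lies in a cycle of length `n`, all do. This
makes the graph grow in a forced way from a short cycle, and it must be a known finite graph.
Finiteness is never assumed: an injective adjacency-preserving map from a finite cubic graph has an
image closed under taking neighbours, so connectedness makes it onto (`nonempty_iso`).

Multigraphs reduce to simple graphs. A loop would turn every edge at its vertex into a loop and make
the degree even. If one edge has a parallel, all do, which leaves only the theta graph.

In a simple graph, a triangle forces `K₄`. A 4-cycle without triangles gives `K₃,₃` if two vertices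
have the same neighbours, and the cube otherwise. In girth `5` the question is whether a 2-path lies
in only one pentagon. If so, the pentagons fit together as the faces of a dodecahedron. If not, the
two pentagons through a 2-path use both ways of extending it at an end, so each 3-arc lies in a
pentagon, and this forces the Petersen graph. -/

namespace SimpleGraph

variable {V : Type*} {G : SimpleGraph V}

/-! ### Cubic symmetric simple graphs: 2-paths and recognition -/

/-- A connected cubic simple graph whose automorphisms act transitively on the arcs. -/
structure IsCubicSymmetric (G : SimpleGraph V) : Prop where
  reachable : ∀ x y, Relation.ReflTransGen G.Adj x y
  cubic : ∀ x, ∃ a b c, a ≠ b ∧ a ≠ c ∧ b ≠ c ∧ ∀ y, G.Adj x y ↔ y = a ∨ y = b ∨ y = c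
  arcTransitive : ∀ ⦃x y x' y'⦄, G.Adj x y → G.Adj x' y' → ∃ φ : G ≃g G, φ x = x' ∧ φ y = y'

lemma injective_vecCons_three {a b c : V} (hab : a ≠ b) (hac : a ≠ c) (hbc : b ≠ c) :
    Function.Injective ![a, b, c] := by
  intro i j hij
  fin_cases i <;> fin_cases j <;> first
    | rfl
    | exact absurd hij ‹_›
    | exact absurd hij.symm ‹_›

namespace IsCubicSymmetric

lemma eq_or_eq_or_eq (hG : G.IsCubicSymmetric) {x a b c y : V} (ha : G.Adj x a) (hb : G.Adj x b)
    (hc : G.Adj x c) (hab : a ≠ b) (hac : a ≠ c) (hbc : b ≠ c) (hy : G.Adj x y) :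
    y = a ∨ y = b ∨ y = c := by
  obtain ⟨a', b', c', -, -, -, h⟩ := hG.cubic x
  rw [h] at ha hb hc hy
  grind

lemma exists_third (hG : G.IsCubicSymmetric) (x a b : V) :
    ∃ c, G.Adj x c ∧ c ≠ a ∧ c ≠ b := by
  obtain ⟨a', b', c', h1, h2, h3, h⟩ := hG.cubic x
  have ha' := (h a').2 (by simp)
  have hb' := (h b').2 (by simp)
  have hc' := (h c').2 (by simp)
  grind

/-- A symmetric automorphism-invariant property of `2`-paths `a, x, b` holds for all of them as soon
as it holds for one: an automorphism that maps the third neighbour of one midpoint to the third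
neighbour of another midpoint maps the one `2`-path to the other. -/
lemma forall_twoPath (hG : G.IsCubicSymmetric) {P : V → V → V → Prop}
    (hsymm : ∀ a x b, P a x b → P b x a)
    (hinv : ∀ (φ : G ≃g G) a x b, P a x b → P (φ a) (φ x) (φ b))
    {a x b : V} (ha : G.Adj x a) (hb : G.Adj x b) (hab : a ≠ b) (h : P a x b)
    ⦃a' x' b' : V⦄ (ha' : G.Adj x' a') (hb' : G.Adj x' b') (hab' : a' ≠ b') : P a' x' b' := by
  obtain ⟨c, hc, hca, hcb⟩ := hG.exists_third x a b
  obtain ⟨c', hc', hca', hcb'⟩ := hG.exists_third x' a' b'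
  obtain ⟨φ, rfl, rfl⟩ := hG.arcTransitive hc hc'
  have h1 := hG.eq_or_eq_or_eq ha' hb' hc' hab' hca'.symm hcb'.symm (φ.map_adj_iff.2 ha)
  have h2 := hG.eq_or_eq_or_eq ha' hb' hc' hab' hca'.symm hcb'.symm (φ.map_adj_iff.2 hb)
  have e1 : φ a ≠ φ c := fun h => hca (φ.injective h).symm
  have e2 : φ b ≠ φ c := fun h => hcb (φ.injective h).symm
  have e3 : φ a ≠ φ b := fun h => hab (φ.injective h)
  have := hinv φ _ _ _ h
  -- `φ` maps `{a, b}` onto `{a', b'}`, in either order; `hsymm` settles the reversed one.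
  rcases h1 with h1 | h1 | h1 <;> rcases h2 with h2 | h2 | h2
  all_goals first
    | exact absurd h1 e1
    | exact absurd h2 e2
    | exact absurd (h1.trans h2.symm) e3
    | skip
  · rwa [h1, h2] at this
  · rw [h1, h2] at this
    exact hsymm _ _ _ this

/-- An injective map from a finite cubic graph, given by a list of neighbours of each vertex, to a
connected cubic graph that preserves adjacency yields an isomorphism. -/
lemma nonempty_iso (hG : G.IsCubicSymmetric) {W W' : Type*} [Nonempty W] {H : SimpleGraph W'}
    (e : W → W') (he : Function.Bijective e) (nb : W → Fin 3 → W)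
    (hH : ∀ a b, H.Adj (e a) (e b) ↔ ∃ k, nb a k = b) (hnb : ∀ a, Function.Injective (nb a))
    (f : W → V) (hf : Function.Injective f) (hadj : ∀ a k, G.Adj (f a) (f (nb a k))) :
    Nonempty (H ≃g G) := by
  -- The images of the three neighbours of `a` already exhaust the neighbours of `f a`. Hence
  -- adjacency is reflected as well, and the range of `f` is closed under adjacency.
  have hlift : ∀ a y, G.Adj (f a) y → ∃ k, f (nb a k) = y := by
    intro a y hy
    have key : ∀ k l, k ≠ l → f (nb a k) ≠ f (nb a l) := fun k l hkl h => hkl (hnb a (hf h))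
    rcases hG.eq_or_eq_or_eq (hadj a 0) (hadj a 1) (hadj a 2) (key _ _ (by decide))
      (key _ _ (by decide)) (key _ _ (by decide)) hy with h | h | h
    exacts [⟨_, h.symm⟩, ⟨_, h.symm⟩, ⟨_, h.symm⟩]
  have hsurj : Function.Surjective f := by
    intro y
    obtain ⟨w⟩ := ‹Nonempty W›
    induction hG.reachable (f w) y with
    | refl => exact ⟨w, rfl⟩
    | tail _ h ih =>
      obtain ⟨a, rfl⟩ := ih
      obtain ⟨k, hk⟩ := hlift a _ h
      exact ⟨_, hk⟩
  have main : ∀ a b, G.Adj (f a) (f b) ↔ H.Adj (e a) (e b) := by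
    intro a b
    rw [hH]
    constructor
    · intro h
      obtain ⟨k, hk⟩ := hlift a _ h
      exact ⟨k, hf hk⟩
    · rintro ⟨k, rfl⟩
      exact hadj a k
  let ε := (Equiv.ofBijective e he).symm
  refine ⟨⟨ε.trans (Equiv.ofBijective f ⟨hf, hsurj⟩), ?_⟩⟩
  intro a b
  obtain ⟨a, rfl⟩ := he.2 a
  obtain ⟨b, rfl⟩ := he.2 b
  have hε : ∀ a, ε (e a) = a := fun a => (Equiv.ofBijective e he).symm_apply_apply a
  change G.Adj (f (ε (e a))) (f (ε (e b))) ↔ _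
  rw [hε, hε]
  exact main a b

/-! ### Girth 3 and 4 -/

/-- A cubic symmetric graph with a triangle is `K₄`. -/
lemma nonempty_iso_completeGraph (hG : G.IsCubicSymmetric) {x a b : V} (ha : G.Adj x a)
    (hb : G.Adj x b) (hab : G.Adj a b) : Nonempty ((⊤ : SimpleGraph (Fin 4)) ≃g G) := by
  have key := hG.forall_twoPath (P := fun a _ b => G.Adj a b) (fun _ _ _ h => h.symm)
    (fun φ _ _ _ h => φ.map_adj_iff.2 h) ha hb hab.ne hab
  obtain ⟨c, hc, hca, hcb⟩ := hG.exists_third x a b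
  have hac := key ha hc hca.symm
  have hbc := key hb hc hcb.symm
  have hadj : ∀ i j : Fin 4, i ≠ j → G.Adj (![x, a, b, c] i) (![x, a, b, c] j) := by
    intro i j hij
    fin_cases i <;> fin_cases j <;>
      first | exact absurd rfl hij | assumption | (apply SimpleGraph.Adj.symm; assumption)
  refine hG.nonempty_iso id Function.bijective_id (fun i : Fin 4 => ![i + 1, i + 2, i + 3])
    (by simp only [top_adj, id]; decide) (by decide) ![x, a, b, c] ?_ ?_
  · intro i j hij
    by_contra hne
    exact (hadj i j hne).ne hij
  · exact fun i k => hadj _ _ (by revert i k; decide)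

/-- A cubic symmetric graph in which two vertices have the same neighbours is `K₃,₃`. -/
lemma nonempty_iso_completeBipartiteGraph (hG : G.IsCubicSymmetric) {x y : V} (hxy : x ≠ y)
    (h : ∀ z, G.Adj x z → G.Adj y z) :
    Nonempty (completeBipartiteGraph (Fin 3) (Fin 3) ≃g G) := by
  have twin : ∀ v, ∃ w, v ≠ w ∧ ∀ z, G.Adj v z → G.Adj w z := by
    intro v
    obtain ⟨a, _, _, -, -, -, ha⟩ := hG.cubic x
    obtain ⟨b, _, _, -, -, -, hb⟩ := hG.cubic v
    obtain ⟨φ, rfl, -⟩ := hG.arcTransitive ((ha a).2 (.inl rfl)) ((hb b).2 (.inl rfl))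
    refine ⟨φ y, fun h => hxy (φ.injective h), fun z hz => ?_⟩
    obtain ⟨z, rfl⟩ := φ.surjective z
    exact φ.map_adj_iff.2 (h _ (φ.map_adj_iff.1 hz))
  obtain ⟨a, b, c, hab, hac, hbc, hx⟩ := hG.cubic x
  have hxa := (hx a).2 (by simp)
  have hxb := (hx b).2 (by simp)
  have hxc := (hx c).2 (by simp)
  obtain ⟨z, haz, hzx, hzy⟩ := hG.exists_third a x y
  -- Both neighbourhoods have three elements, so an inclusion between them is an equality.
  have rev : ∀ u v, (∀ z, G.Adj u z → G.Adj v z) → ∀ z, G.Adj v z → G.Adj u z := by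
    intro u v huv z hz
    obtain ⟨p, q, r, h1, h2, h3, hu⟩ := hG.cubic u
    have hup := (hu p).2 (by simp)
    have huq := (hu q).2 (by simp)
    have hur := (hu r).2 (by simp)
    rw [hu]
    exact hG.eq_or_eq_or_eq (huv _ hup) (huv _ huq) (huv _ hur) h1 h2 h3 hz
  have hz : ∀ u, G.Adj x u → G.Adj u z := by
    -- A twin of `a`, `b` or `c` is adjacent to `x`, hence is again one of these three. An
    -- equivalence relation on three elements without singleton classes has one class, so all three
    -- share the neighbour `z`.
    obtain ⟨a', ha', ha''⟩ := twin a
    obtain ⟨b', hb', hb''⟩ := twin b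
    obtain ⟨c', hc', hc''⟩ := twin c
    have hxa' := (ha'' x hxa.symm).symm
    have hxb' := (hb'' x hxb.symm).symm
    have hxc' := (hc'' x hxc.symm).symm
    have hra := rev _ _ ha''
    have hrb := rev _ _ hb''
    have hrc := rev _ _ hc''
    rw [hx] at hxa' hxb' hxc'
    intro u hu
    rw [hx] at hu
    rcases hu with rfl | rfl | rfl
    · exact haz
    all_goals grind
  have hadj : ∀ i j : Fin 3, G.Adj (![x, y, z] i) (![a, b, c] j) := by
    intro i j
    fin_cases i <;> fin_cases j <;> first
      | assumption
      | exact h _ ‹_›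
      | exact (hz _ ‹_›).symm
  have i1 := injective_vecCons_three hxy hzx.symm hzy.symm
  have i2 := injective_vecCons_three hab hac hbc
  have hne : ∀ i j : Fin 3, ![x, y, z] i ≠ ![a, b, c] j := fun i j => (hadj i j).ne
  refine hG.nonempty_iso id Function.bijective_id
    (Sum.elim (fun _ k => Sum.inr k) (fun _ k => Sum.inl k) : Fin 3 ⊕ Fin 3 → _)
    (by rintro (i | i) (j | j) <;> simp) (by rintro (i | i) j k h <;> simpa using h)
    (Sum.elim ![x, y, z] ![a, b, c]) (i1.sumElim i2 hne) ?_
  rintro (i | i) k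
  · exact hadj i k
  · exact (hadj k i).symm

/-- A triangle-free cubic symmetric graph with a `4`-cycle in which no two vertices have the same
neighbours is the cube. -/
lemma nonempty_iso_cubeGraph (hG : G.IsCubicSymmetric)
    (h3 : ∀ a b c, G.Adj a b → G.Adj b c → ¬ G.Adj a c)
    (hx : ∀ x y, x ≠ y → ∃ z, G.Adj x z ∧ ¬ G.Adj y z)
    {o a b y : V} (ha : G.Adj o a) (hb : G.Adj o b) (hab : a ≠ b) (hy : y ≠ o)
    (hay : G.Adj a y) (hby : G.Adj b y) : Nonempty (cubeGraph ≃g G) := by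
  have key := hG.forall_twoPath (P := fun a x b => ∃ y, y ≠ x ∧ G.Adj a y ∧ G.Adj b y)
    (fun _ _ _ ⟨y, h1, h2, h3⟩ => ⟨y, h1, h3, h2⟩)
    (fun φ _ _ _ ⟨y, h1, h2, h3⟩ => ⟨φ y, fun h => h1 (φ.injective h), φ.map_adj_iff.2 h2,
      φ.map_adj_iff.2 h3⟩) ha hb hab ⟨y, hy, hay, hby⟩
  obtain ⟨c, hc, hca, hcb⟩ := hG.exists_third o a b
  -- A second common neighbour of `a`, `b`, `c` would be a twin of `o`.
  have no3 : ∀ y, y ≠ o → G.Adj a y → G.Adj b y → ¬ G.Adj c y := by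
    intro y hy h1 h2 h3
    obtain ⟨z, hz, hyz⟩ := hx o y hy.symm
    rcases hG.eq_or_eq_or_eq ha hb hc hab hca.symm hcb.symm hz with rfl | rfl | rfl
    exacts [hyz h1.symm, hyz h2.symm, hyz h3.symm]
  obtain ⟨w, hw, haw, hcw⟩ := key ha hc hca.symm
  obtain ⟨u, hu, hbu, hcu⟩ := key hb hc hcb.symm
  have hcy := no3 y hy hay hby
  have hbw : ¬ G.Adj b w := fun h => no3 w hw haw h hcw
  have hau : ¬ G.Adj a u := fun h => no3 u hu h hbu hcu
  have hyw : y ≠ w := by rintro rfl; exact hcy hcw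
  have hyu : y ≠ u := by rintro rfl; exact hcy hcu
  have hwu : w ≠ u := by rintro rfl; exact hau haw
  obtain ⟨t, hta, hyt, hwt⟩ := key hay haw hyw
  have htb : t ≠ b := by rintro rfl; exact hbw hwt.symm
  obtain ⟨s, hsb, hys, hus⟩ := key hby hbu hyu
  have hsa : s ≠ a := by rintro rfl; exact hau hus.symm
  -- Both are the neighbour of `y` other than `a` and `b`. This vertex is the antipode of `o`.
  obtain rfl : s = t := by
    rcases hG.eq_or_eq_or_eq hay.symm hby.symm hyt hab hta.symm htb.symm hys with h | h | h
    exacts [absurd h hsa, absurd h hsb, h]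
  have hoy : ¬ G.Adj o y := h3 _ _ _ ha hay
  have hos : o ≠ s := by rintro rfl; exact hoy hys.symm
  have has : ¬ G.Adj a s := h3 _ _ _ hay hys
  have hbs : ¬ G.Adj b s := h3 _ _ _ hby hys
  have hcs : ¬ G.Adj c s := h3 _ _ _ hcu hus
  have hcs' : c ≠ s := by rintro rfl; exact hcy hys.symm
  have how : ¬ G.Adj o w := h3 _ _ _ ha haw
  have hou : ¬ G.Adj o u := h3 _ _ _ hb hbu
  -- Coordinates with `o` as origin and `a`, `b`, `c` as unit vectors: `y = 110`, `w = 101`, `u =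
  -- 011`, `s = 111`.
  let g : Bool → Bool → Bool → V := fun p q r =>
    cond p (cond q (cond r s y) (cond r w a)) (cond q (cond r u b) (cond r c o))
  refine hG.nonempty_iso id Function.bijective_id
    (fun (w : Fin 3 → Bool) k => Function.update w k (!(w k)))
    (by unfold cubeGraph; simp only [fromRel_adj, id]; decide) (by decide)
    (fun w => g (w 0) (w 1) (w 2)) ?_ ?_
  · have hg : ∀ p q r p' q' r', g p q r = g p' q' r' → p = p' ∧ q = q' ∧ r = r' := by
      have := ha.ne; have := hb.ne; have := hc.ne; have := hay.ne; have := hby.ne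
      have := haw.ne; have := hcw.ne; have := hbu.ne; have := hcu.ne; have := hys.ne
      have := hwt.ne; have := hus.ne
      have : a ≠ u := by rintro rfl; exact hou ha
      have : b ≠ w := by rintro rfl; exact how hb
      have : c ≠ y := by rintro rfl; exact hoy hc
      intro p q r p' q' r' h
      cases p <;> cases q <;> cases r <;> cases p' <;> cases q' <;> cases r' <;>
        first
          | exact ⟨rfl, rfl, rfl⟩
          | (exfalso; simp only [g, cond] at h; first
              | contradiction
              | exact absurd h.symm ‹_›)
    intro w w' h
    obtain ⟨h0, h1, h2⟩ := hg _ _ _ _ _ _ h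
    ext i
    fin_cases i <;> simp_all
  · have e0 : ∀ p q r, G.Adj (g p q r) (g (!p) q r) := by
      intro p q r
      cases p <;> cases q <;> cases r <;>
        first | assumption | (apply SimpleGraph.Adj.symm; assumption)
    have e1 : ∀ p q r, G.Adj (g p q r) (g p (!q) r) := by
      intro p q r
      cases p <;> cases q <;> cases r <;>
        first | assumption | (apply SimpleGraph.Adj.symm; assumption)
    have e2 : ∀ p q r, G.Adj (g p q r) (g p q (!r)) := by
      intro p q r
      cases p <;> cases q <;> cases r <;>
        first | assumption | (apply SimpleGraph.Adj.symm; assumption)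
    intro w k
    fin_cases k
    exacts [e0 _ _ _, e1 _ _ _, e2 _ _ _]

/-! ### Girth 5: the Petersen graph -/

lemma add_one_four_times : ∀ i : ZMod 5, i + 1 + 1 + 1 + 1 = i - 1 := by decide

lemma add_one_three_times : ∀ i : ZMod 5, i + 1 + 1 + 1 = i - 1 - 1 := by decide

/-- If the two neighbours of `v i` on the closed walk coincided, the other three edges would form a
triangle. So a closed walk of length five needs no separate hypothesis of injectivity. -/
lemma ne_of_pentagon (h3 : ∀ a b c, G.Adj a b → G.Adj b c → ¬ G.Adj a c) {v : ZMod 5 → V}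
    (hv : ∀ i, G.Adj (v i) (v (i + 1))) (i : ZMod 5) : v (i + 1) ≠ v (i - 1) := by
  intro h
  have e := hv (i + 1 + 1 + 1)
  rw [add_one_four_times, ← h] at e
  exact h3 _ _ _ (hv (i + 1)) (hv (i + 1 + 1)) e.symm

/-- A cubic symmetric graph of girth `5` in which any `3`-arc lies in a pentagon is the Petersen
graph. -/
lemma nonempty_iso_petersen (hG : G.IsCubicSymmetric)
    (h3 : ∀ a b c, G.Adj a b → G.Adj b c → ¬ G.Adj a c)
    (h4 : ∀ a b c d, G.Adj a b → G.Adj b c → G.Adj c d → G.Adj d a → a = c ∨ b = d)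
    {v : ZMod 5 → V} (hv : ∀ i, G.Adj (v i) (v (i + 1)))
    (h5 : ∀ a b c d, G.Adj a b → G.Adj b c → G.Adj c d → a ≠ c → b ≠ d →
      ∃ z, G.Adj a z ∧ G.Adj d z) :
    Nonempty (generalizedPetersen 5 2 ≃g G) := by
  have hv' : ∀ i, G.Adj (v i) (v (i - 1)) := fun i => by simpa using (hv (i - 1)).symm
  have hv2 := ne_of_pentagon h3 hv
  choose p hp hp1 hp2 using fun i => hG.exists_third (v i) (v (i + 1)) (v (i - 1))
  have hpp : ∀ i, G.Adj (p i) (p (i + 2)) := by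
    intro i
    have e2 : v (i + 1 + 1 + 1 + 1) = v (i - 1) := by rw [add_one_four_times]
    have e3 : i + 1 + 1 - 1 = i + 1 := by ring
    have e4 : i + 1 + 1 = i + 2 := by ring
    -- The 3-arc `p i, v i, v (i + 1), v (i + 2)` closes up through `z`. Taking `z` on the original
    -- pentagon would give a 4-cycle or a triangle, so `z = p (i + 2)`.
    obtain ⟨z, hz1, hz2⟩ := h5 _ _ _ _ (hp i).symm (hv i) (hv (i + 1)) (hp1 i) (by
      have := hv2 (i + 1); rw [add_sub_cancel_right] at this; exact this.symm)
    rcases hG.eq_or_eq_or_eq (hv (i + 1 + 1)) (hv' (i + 1 + 1)) (hp (i + 1 + 1)) (hv2 _)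
      (hp1 _).symm (hp2 _).symm hz2 with rfl | rfl | rfl
    · rcases h4 _ _ _ _ hz1 (hv (i + 1 + 1 + 1)) (by rw [e2]; exact (hv' i).symm) (hp i) with h | h
      · rw [e2] at h
        exact absurd h (hp2 i)
      · have := hv2 (i - 1)
        rw [sub_add_cancel, ← h] at this
        exact absurd (by rw [add_one_three_times]) this
    · rw [e3] at hz1
      exact absurd hz1.symm (h3 _ _ _ (hv i).symm (hp i))
    · rwa [e4] at hz1
  have hpp' : ∀ i, G.Adj (p i) (p (i - 2)) := fun i => by simpa using (hpp (i - 2)).symm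
  -- Distinct indices modulo `5` differ by `±1` or `±2`, so only these differences need to be
  -- checked for injectivity.
  have hij : ∀ i j : ZMod 5, i ≠ j → j = i + 1 ∨ i = j + 1 ∨ j = i + 2 ∨ i = j + 2 := by decide
  have hva : ∀ i, v i ≠ v (i + 2) := fun i h => hv2 (i + 1) (by
    rw [add_sub_cancel_right, h]; congr 1; ring)
  have hvi : Function.Injective v := by
    intro i j h
    by_contra hne
    rcases hij i j hne with rfl | rfl | rfl | rfl
    exacts [(hv i).ne h, (hv j).ne' h, hva i h, hva j h.symm]
  have hvp : ∀ i j, v i ≠ p j := by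
    intro i j h
    have := hp j
    rw [← h] at this
    rcases eq_or_ne j i with rfl | hne
    · exact this.ne rfl
    rcases hij i j hne.symm with rfl | rfl | rfl | rfl
    · exact hp2 (i + 1) (by simpa using h.symm)
    · exact hp1 _ h.symm
    · exact h3 _ _ _ (hv i) (by simpa [add_assoc, one_add_one_eq_two] using hv (i + 1)) this.symm
    · exact h3 _ _ _ (hv j) (by simpa [add_assoc, one_add_one_eq_two] using hv (j + 1)) this
  have hpa : ∀ i, p i ≠ p (i + 1) := by
    intro i h
    have := hp i
    rw [h] at this
    exact h3 _ _ _ (hv i) (hp (i + 1)) this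
  have hpi : Function.Injective p := by
    intro i j h
    by_contra hne
    rcases hij i j hne with rfl | rfl | rfl | rfl
    exacts [hpa i h, hpa j h.symm, (hpp i).ne h, (hpp j).ne' h]
  refine hG.nonempty_iso id Function.bijective_id
    (Sum.elim (fun i => ![.inl (i + 1), .inl (i - 1), .inr i])
      (fun i => ![.inr (i + 2), .inr (i - 2), .inl i]) : ZMod 5 ⊕ ZMod 5 → _)
    ?_ (by decide) (Sum.elim v p) (hvi.sumElim hpi hvp) ?_
  · unfold generalizedPetersen
    simp only [fromRel_adj, id]
    rintro (i | i) (j | j)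
    all_goals
      simp only [Sum.elim_inl, Sum.elim_inr]
      revert i j
      decide
  · rintro (i | i) k <;> fin_cases k
    exacts [hv i, hv' i, hp i, hpp i, hpp' i, (hp i).symm]

/-! ### Girth 5: the dodecahedron -/

/-- The neighbours in the dodecahedron: the vertices `(i, 0)` form a pentagon, `(i, 1)` is joined
to `(i, 0)`, `(i, 2)` to `(i, 1)` and `(i + 1, 1)`, `(i, 3)` to `(i, 2)`, and the `(i, 3)` form a
pentagon. -/
def dodecahedronNeighbor : ZMod 5 × Fin 4 → Fin 3 → ZMod 5 × Fin 4 := fun a =>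
  ![![(a.1 + 1, 0), (a.1 - 1, 0), (a.1, 1)], ![(a.1, 0), (a.1, 2), (a.1 - 1, 2)],
    ![(a.1, 1), (a.1 + 1, 1), (a.1, 3)], ![(a.1, 2), (a.1 + 1, 3), (a.1 - 1, 3)]] a.2

lemma dodecahedronNeighbor_injective : ∀ a, Function.Injective (dodecahedronNeighbor a) := by
  decide

/-- Distinct vertices of the dodecahedron are joined by a path of length at most `4`, or by a path
of length `5` whose first three vertices lie in a pentagon that does not contain the fourth one. -/
lemma exists_dodecahedron_path (a z : ZMod 5 × Fin 4) : a = z ∨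
    ∃ k, dodecahedronNeighbor a k = z ∨
    ∃ l, let b := dodecahedronNeighbor a k; let c := dodecahedronNeighbor b l
      a ≠ c ∧ (c = z ∨
    ∃ m, let d := dodecahedronNeighbor c m
      b ≠ d ∧ (d = z ∨
    ∃ n, let e := dodecahedronNeighbor d n
      c ≠ e ∧ (e = z ∨ (∃ o, dodecahedronNeighbor e o = z) ∧
    ∃ m', m ≠ m' ∧ ∃ n' o', dodecahedronNeighbor (dodecahedronNeighbor
      (dodecahedronNeighbor c m') n') o' = a))) := by
  revert a z
  decide +kernel

/-- The labelling of the dodecahedron by `ZMod 5 × Fin 4` compared with `GP(10, 2)`. -/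
def dodecahedronToPetersen (a : ZMod 5 × Fin 4) : ZMod 10 ⊕ ZMod 10 :=
  ![.inr (2 * a.1.val : ℕ), .inl (2 * a.1.val : ℕ), .inl (2 * a.1.val + 1 : ℕ),
    .inr (2 * a.1.val + 1 : ℕ)] a.2

lemma dodecahedronToPetersen_bijective : Function.Bijective dodecahedronToPetersen := by
  constructor
  · unfold Function.Injective
    decide +kernel
  · unfold Function.Surjective
    decide +kernel

/-- The inner edges of `GP(10, 2)` form two pentagons, on the even and on the odd indices; these are
the layers `0` and `3`. The outer 10-cycle alternates between the layers `1` and `2`. -/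
lemma generalizedPetersen_adj_dodecahedron (a b : ZMod 5 × Fin 4) :
    (generalizedPetersen 10 2).Adj (dodecahedronToPetersen a) (dodecahedronToPetersen b) ↔
      ∃ k, dodecahedronNeighbor a k = b := by
  have h1 : (generalizedPetersen 10 2).Adj (dodecahedronToPetersen a) (dodecahedronToPetersen b) ↔
      ∃ k, (Sum.elim (fun i => ![.inl (i + 1), .inl (i - 1), .inr i])
      (fun i => ![.inr (i + 2), .inr (i - 2), .inl i]) : ZMod 10 ⊕ ZMod 10 → Fin 3 → _)
        (dodecahedronToPetersen a) k = dodecahedronToPetersen b := by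
    unfold generalizedPetersen
    simp only [fromRel_adj]
    generalize dodecahedronToPetersen a = x
    generalize dodecahedronToPetersen b = y
    rcases x with (i | i) <;> rcases y with (j | j)
    all_goals
      simp only [Sum.elim_inl, Sum.elim_inr]
      revert i j
      decide +kernel
  rw [h1]
  clear h1
  revert a b
  decide +kernel

/-- A cubic symmetric graph of girth `5` in which any `2`-path lies in a unique pentagon is the
dodecahedron graph. -/
lemma nonempty_iso_dodecahedron (hG : G.IsCubicSymmetric)
    (h3 : ∀ a b c, G.Adj a b → G.Adj b c → ¬ G.Adj a c)
    (h4 : ∀ a b c d, G.Adj a b → G.Adj b c → G.Adj c d → G.Adj d a → a = c ∨ b = d)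
    {v : ZMod 5 → V} (hv : ∀ i, G.Adj (v i) (v (i + 1)))
    (h5 : ∀ a x b, G.Adj a x → G.Adj x b → a ≠ b → ∃ d e, G.Adj b d ∧ G.Adj d e ∧ G.Adj e a)
    (huniq : ∀ a x b d e d' e', G.Adj a x → G.Adj x b → a ≠ b → G.Adj b d → G.Adj d e →
      G.Adj e a → G.Adj b d' → G.Adj d' e' → G.Adj e' a → d = d' ∧ e = e') :
    Nonempty (generalizedPetersen 10 2 ≃g G) := by
  have hv' : ∀ i, G.Adj (v i) (v (i - 1)) := fun i => by simpa using (hv (i - 1)).symm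
  have hv2 := ne_of_pentagon h3 hv
  choose p hp hp1 hp2 using fun i => hG.exists_third (v i) (v (i + 1)) (v (i - 1))
  -- The face across the edge `v i, v (i + 1)`: the pentagon on `p i, v i, v (i + 1)` cannot
  -- continue to `v (i + 2)`, since `v i, v (i + 1), v (i + 2)` would then lie in two pentagons.
  have hq : ∀ i, ∃ q, G.Adj (p i) q ∧ G.Adj q (p (i + 1)) := by
    intro i
    obtain ⟨d, e, h1, h2, h3'⟩ := h5 _ _ _ (hp i).symm (hv i) (hp1 i)
    rcases hG.eq_or_eq_or_eq (hv (i + 1)) (hv' (i + 1)) (hp (i + 1)) (hv2 _) (hp1 _).symm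
      (hp2 _).symm h1 with rfl | rfl | rfl
    · have := (huniq _ _ _ _ _ _ _ (hv i) h1 (fun h => hv2 (i + 1) (by rw [← h]; simp)) h2 h3'
        (hp i).symm (hv (i + 1 + 1)) (hv _)
        (by rw [add_one_four_times]; exact (hv' i).symm)).2
      exact absurd (this.trans (by rw [add_one_four_times])) (hp2 i)
    · rw [add_sub_cancel_right] at h2
      exact absurd h3'.symm (h3 _ _ _ (hp i).symm h2)
    · exact ⟨e, h3'.symm, h2.symm⟩
  choose q hpq hqp using hq
  have hqp' : ∀ i, G.Adj (p i) (q (i - 1)) := fun i => by simpa using (hqp (i - 1)).symm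
  have hqv : ∀ i, v i ≠ q i := by
    intro i h
    have := hqp i
    rw [← h] at this
    exact h3 _ _ _ (hv i) (hp (i + 1)) this
  have hqv' : ∀ i, q i ≠ v (i + 1) := by
    intro i h
    have := hpq i
    rw [h] at this
    exact h3 _ _ _ (hp i) this (hv i)
  -- Otherwise the 2-path `v i, p i, q i` lies in two pentagons, one on each side.
  have hqq : ∀ i, q i ≠ q (i - 1) := by
    intro i h
    have h1 := (hqp' i).symm
    have h2 := (hpq (i - 1)).symm
    rw [← h] at h1 h2
    have := (huniq _ _ _ _ _ _ _ (hp i) (hpq i) (hqv i) (hqp i) (hp (i + 1)).symm (hv i).symm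
      h2 (hp (i - 1)).symm (hv' i).symm).2
    exact hv2 i this
  have hpp : ∀ i, p i ≠ p (i + 1) := by
    intro i h
    have := hp i
    rw [h] at this
    exact h3 _ _ _ (hv i) (hp (i + 1)) this
  choose r hr hr1 hr2 using fun i => hG.exists_third (q i) (p i) (p (i + 1))
  -- The pentagon on `q i, p (i + 1), q (i + 1)` must leave through `r i` and `r (i + 1)`: any other
  -- exit gives a triangle or a second pentagon on a 2-path of a known face.
  have hrr : ∀ i, G.Adj (r i) (r (i + 1)) := by
    intro i
    have hne : q i ≠ q (i + 1) := by simpa using (hqq (i + 1)).symm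
    obtain ⟨d, e, h1, h2, h3'⟩ := h5 _ _ _ (hqp i) (hpq (i + 1)) hne
    rcases hG.eq_or_eq_or_eq (hpq (i + 1)).symm (hqp (i + 1)) (hr (i + 1)) (hpp _) (hr1 _).symm
      (hr2 _).symm h1 with rfl | rfl | rfl
    · exact absurd h3' (h3 _ _ _ h2.symm (hqp i).symm)
    · have := (huniq _ _ _ _ _ _ _ (hpq (i + 1)) h1 (hpp _) h2 h3' (hqp i)
        (hp (i + 1 + 1)).symm (hv (i + 1)).symm (hp (i + 1))).2
      exact absurd this (hqv' i)
    rcases hG.eq_or_eq_or_eq (hpq i).symm (hqp i) (hr i) (hpp _) (hr1 _).symm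
      (hr2 _).symm h3'.symm with rfl | rfl | rfl
    · have := (huniq _ _ _ _ _ _ _ (hpq i) (hqp i) (hpp _) (hpq (i + 1)) h1
        h2 (hp (i + 1)).symm (hv i).symm (hp i)).1
      exact absurd this.symm (hqv _)
    · exact absurd h2 (h3 _ _ _ h1.symm (hpq (i + 1)).symm)
    · exact h2.symm
  have hrr' : ∀ i, G.Adj (r i) (r (i - 1)) := fun i => by simpa using (hrr (i - 1)).symm
  have hqr : ∀ i, q i ≠ r (i + 1) := by
    intro i h
    have := hr (i + 1)
    rw [← h] at this
    exact h3 _ _ _ (hqp i) (hpq (i + 1)) this.symm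
  have hqr' : ∀ i, q i ≠ r (i - 1) := by
    intro i h
    have := hr (i - 1)
    rw [← h] at this
    exact h3 _ _ _ (hpq i).symm (hqp' i) this.symm
  have hr3 : ∀ i, r (i + 1) ≠ r (i - 1) := by
    intro i h
    have h1 := (hr (i - 1)).symm
    rw [← h] at h1
    have := (huniq _ _ _ _ _ _ _ (hr i) (hrr i) (hqr i) (hr (i + 1)).symm (hpq (i + 1)).symm
      (hqp i).symm h1 (hqp' i).symm (hpq i)).2
    exact hpp i this.symm
  let f : ZMod 5 × Fin 4 → V := fun a => ![v, p, q, r] a.2 a.1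
  have hadj : ∀ a k, G.Adj (f a) (f (dodecahedronNeighbor a k)) := by
    rintro ⟨i, s⟩ k
    fin_cases s <;> fin_cases k
    exacts [hv i, hv' i, hp i, (hp i).symm, hpq i, hqp' i, (hpq i).symm, hqp i, hr i, (hr i).symm,
      hrr i, hrr' i]
  have hvq' : ∀ i, v i ≠ q (i - 1) := fun i => by simpa using (hqv' (i - 1)).symm
  have hloc : ∀ a, Function.Injective fun k => f (dodecahedronNeighbor a k) := by
    rintro ⟨i, s⟩
    have key : ∀ {a b c : V}, a ≠ b → a ≠ c → b ≠ c → ∀ g : Fin 3 → V, g 0 = a → g 1 = b →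
        g 2 = c → Function.Injective g := by
      rintro _ _ _ h1 h2 h3 g rfl rfl rfl
      intro k l hkl
      fin_cases k <;> fin_cases l <;> first
        | rfl
        | exact absurd hkl ‹_›
        | exact absurd hkl.symm ‹_›
    fin_cases s
    exacts [key (hv2 i) (hp1 i).symm (hp2 i).symm _ rfl rfl rfl,
      key (hqv i) (hvq' i) (hqq i) _ rfl rfl rfl,
      key (hpp i) (hr1 i).symm (hr2 i).symm _ rfl rfl rfl,
      key (hqr i) (hqr' i) (hr3 i) _ rfl rfl rfl]
  have hloc2 : ∀ a k l, a ≠ dodecahedronNeighbor (dodecahedronNeighbor a k) l →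
      f a ≠ f (dodecahedronNeighbor (dodecahedronNeighbor a k) l) := by
    have back : ∀ a k, ∃ m, dodecahedronNeighbor (dodecahedronNeighbor a k) m = a := by
      decide +kernel
    intro a k l hne h
    obtain ⟨m, hm⟩ := back a k
    have : l = m := hloc (dodecahedronNeighbor a k) (by simp only [hm]; exact h.symm)
    exact hne (by rw [this, hm])
  -- A path between two vertices with the same image is mapped to a closed walk. By local
  -- injectivity it does not backtrack inside the path, so length at most `4` contradicts girth `5`.
  -- At length `5` it is a second pentagon on the image of a 2-path that already lies in a face,
  -- against `huniq`.
  have hinj : Function.Injective f := by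
    intro a z h
    obtain h' | ⟨k, h' | ⟨l, hac, h' | ⟨m, hbd, h' | ⟨n, hce, h' | ⟨⟨o, h'⟩, m', hm, n', o', h''⟩⟩⟩⟩⟩ :=
      exists_dodecahedron_path a z
    · exact h'
    · exact ((hadj a k).ne (h.trans (congrArg f h').symm)).elim
    · exact (hloc2 a k l hac (h.trans (congrArg f h').symm)).elim
    · have e := hadj (dodecahedronNeighbor (dodecahedronNeighbor a k) l) m
      rw [h', ← h] at e
      exact (h3 _ _ _ (hadj a k) (hadj _ l) e.symm).elim
    · have e := hadj (dodecahedronNeighbor (dodecahedronNeighbor (dodecahedronNeighbor a k) l) m) n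
      rw [h', ← h] at e
      rcases h4 _ _ _ _ (hadj a k) (hadj _ l) (hadj _ m) e with e' | e'
      · exact (hloc2 _ _ _ hac e').elim
      · exact (hloc2 _ _ _ hbd e').elim
    · have e := hadj (dodecahedronNeighbor (dodecahedronNeighbor (dodecahedronNeighbor
        (dodecahedronNeighbor a k) l) m) n) o
      have e' := hadj (dodecahedronNeighbor (dodecahedronNeighbor (dodecahedronNeighbor
        (dodecahedronNeighbor a k) l) m') n') o'
      rw [h', ← h] at e
      rw [h''] at e'
      exact (hm (hloc _ (huniq _ _ _ _ _ _ _ (hadj a k) (hadj _ l) (hloc2 _ _ _ hac) (hadj _ m)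
        (hadj _ n) e (hadj _ m') (hadj _ n') e').1)).elim
  exact hG.nonempty_iso _ dodecahedronToPetersen_bijective _ generalizedPetersen_adj_dodecahedron
    dodecahedronNeighbor_injective f hinj hadj

/-! ### Putting the simple graph cases together -/

/-- A cubic symmetric graph of girth `5` is the Petersen graph or the dodecahedron graph. -/
lemma nonempty_iso_of_pentagon (hG : G.IsCubicSymmetric)
    (h3 : ∀ a b c, G.Adj a b → G.Adj b c → ¬ G.Adj a c)
    (h4 : ∀ a b c d, G.Adj a b → G.Adj b c → G.Adj c d → G.Adj d a → a = c ∨ b = d)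
    {v : ZMod 5 → V} (hv : ∀ i, G.Adj (v i) (v (i + 1))) :
    Nonempty (generalizedPetersen 5 2 ≃g G) ∨ Nonempty (generalizedPetersen 10 2 ≃g G) := by
  have hv' : ∀ i, G.Adj (v i) (v (i - 1)) := fun i => by simpa using (hv (i - 1)).symm
  have hv2 := ne_of_pentagon h3 hv
  by_cases huniq : ∀ a x b d e d' e', G.Adj a x → G.Adj x b → a ≠ b → G.Adj b d → G.Adj d e →
      G.Adj e a → G.Adj b d' → G.Adj d' e' → G.Adj e' a → d = d' ∧ e = e'
  · refine .inr (hG.nonempty_iso_dodecahedron h3 h4 hv ?_ huniq)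
    have key := hG.forall_twoPath (P := fun a _ b => ∃ d e, G.Adj b d ∧ G.Adj d e ∧ G.Adj e a)
      (fun _ _ _ ⟨d, e, h1, h2, h3⟩ => ⟨e, d, h3.symm, h2.symm, h1.symm⟩)
      (fun φ _ _ _ ⟨d, e, h1, h2, h3⟩ => ⟨φ d, φ e, φ.map_adj_iff.2 h1, φ.map_adj_iff.2 h2,
        φ.map_adj_iff.2 h3⟩) (hv' 0) (hv 0) (hv2 0).symm
      ⟨_, _, hv _, hv _, by rw [add_one_three_times]; simpa using hv (0 - 1 - 1)⟩
    exact fun a x b h1 h2 hab => key h1.symm h2 hab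
  · left
    push Not at huniq
    obtain ⟨a, x, b, d, e, d', e', hax, hxb, hab, hbd, hde, hea, hbd', hde', hea', hne⟩ := huniq
    -- Both inequalities are required because reversing the 2-path exchanges them. The absence of
    -- triangles and 4-cycles yields both from the failure of uniqueness: pentagons sharing a
    -- further vertex coincide.
    have key := hG.forall_twoPath (P := fun a _ b => ∃ d e d' e', G.Adj b d ∧ G.Adj d e ∧
        G.Adj e a ∧ G.Adj b d' ∧ G.Adj d' e' ∧ G.Adj e' a ∧ d ≠ d' ∧ e ≠ e')
      (fun _ _ _ ⟨d, e, d', e', h1, h2, h3, h4, h5, h6, h7, h8⟩ => ⟨e, d, e', d', h3.symm, h2.symm,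
        h1.symm, h6.symm, h5.symm, h4.symm, h8, h7⟩)
      (fun φ _ _ _ ⟨d, e, d', e', h1, h2, h3, h4, h5, h6, h7, h8⟩ => ⟨φ d, φ e, φ d', φ e',
        φ.map_adj_iff.2 h1, φ.map_adj_iff.2 h2, φ.map_adj_iff.2 h3, φ.map_adj_iff.2 h4,
        φ.map_adj_iff.2 h5, φ.map_adj_iff.2 h6, fun h => h7 (φ.injective h),
        fun h => h8 (φ.injective h)⟩) hax.symm hxb hab
      ⟨d, e, d', e', hbd, hde, hea, hbd', hde', hea', by
        rintro rfl
        rcases h4 _ _ _ _ hde hea hea'.symm hde'.symm with h | h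
        · subst h
          exact h3 _ _ _ hax hxb hbd.symm
        · exact hne rfl h, by
        rintro rfl
        rcases h4 _ _ _ _ hbd hde hde'.symm hbd'.symm with h | h
        · subst h
          exact h3 _ _ _ hxb hea hax.symm
        · exact hne h rfl⟩
    refine hG.nonempty_iso_petersen h3 h4 hv fun a b c w hab hbc hcw hac hbw => ?_
    -- the two pentagons through `b, c, w` use both further neighbours of `b`
    obtain ⟨d, e, d', e', h1, h2, h3', h1', h2', h3'', -, hee⟩ := key hbc.symm hcw hbw
    have hec : e ≠ c := by rintro rfl; exact h3 _ _ _ hcw h1 h2.symm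
    have hec' : e' ≠ c := by rintro rfl; exact h3 _ _ _ hcw h1' h2'.symm
    rcases hG.eq_or_eq_or_eq h3'.symm h3''.symm hbc hee hec hec' hab.symm with rfl | rfl | rfl
    · exact ⟨d, h2.symm, h1⟩
    · exact ⟨d', h2'.symm, h1'⟩
    · exact absurd rfl hac

/-- A cubic symmetric simple graph with a cycle of length `3`, `4` or `5`. -/
lemma classification (hG : G.IsCubicSymmetric)
    (hcycle : (∃ a b c, G.Adj a b ∧ G.Adj b c ∧ G.Adj a c) ∨
      (∃ a b c d, G.Adj a b ∧ G.Adj b c ∧ G.Adj c d ∧ G.Adj d a ∧ a ≠ c ∧ b ≠ d) ∨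
      ∃ v : ZMod 5 → V, ∀ i, G.Adj (v i) (v (i + 1))) :
    Nonempty ((⊤ : SimpleGraph (Fin 4)) ≃g G) ∨
      Nonempty (completeBipartiteGraph (Fin 3) (Fin 3) ≃g G) ∨ Nonempty (cubeGraph ≃g G) ∨
      Nonempty (generalizedPetersen 5 2 ≃g G) ∨ Nonempty (generalizedPetersen 10 2 ≃g G) := by
  by_cases h3 : ∃ a b c, G.Adj a b ∧ G.Adj b c ∧ G.Adj a c
  · obtain ⟨a, b, c, h1, h2, h3⟩ := h3
    exact .inl (hG.nonempty_iso_completeGraph h1 h3 h2)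
  by_cases h4 : ∃ a b c d, G.Adj a b ∧ G.Adj b c ∧ G.Adj c d ∧ G.Adj d a ∧ a ≠ c ∧ b ≠ d
  · right
    by_cases htwin : ∃ x y, x ≠ y ∧ ∀ z, G.Adj x z → G.Adj y z
    · obtain ⟨x, y, hxy, h⟩ := htwin
      exact .inl (hG.nonempty_iso_completeBipartiteGraph hxy h)
    · push Not at htwin h3
      obtain ⟨a, b, c, d, h1, h2, h3', h4, hac, hbd⟩ := h4
      exact .inr (.inl (hG.nonempty_iso_cubeGraph h3 htwin h1 h4.symm hbd hac.symm h2 h3'.symm))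
  · obtain ⟨v, hv⟩ := (hcycle.resolve_left h3).resolve_left h4
    push Not at h3 h4
    refine .inr (.inr (.inr (hG.nonempty_iso_of_pentagon h3 (fun a b c d h1 h2 h3 h => ?_) hv)))
    by_contra! hne
    exact hne.2 (h4 a b c d h1 h2 h3 h hne.1)

end IsCubicSymmetric

end SimpleGraph

/-! ### Multigraphs: loops, parallel edges and reduction to simple graphs -/

namespace Graph

variable {α β α' β' : Type*} {X : Graph α β}

/-- The inverse of an isomorphism of multigraphs. -/
def Iso.symm {Y : Graph α' β'} (φ : Iso X Y) : Iso Y X where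
  vertexEquiv := φ.vertexEquiv.symm
  edgeEquiv := φ.edgeEquiv.symm
  isLink_iff e x y := by
    simpa using (φ.isLink_iff (φ.edgeEquiv.symm e) (φ.vertexEquiv.symm x)
      (φ.vertexEquiv.symm y)).symm

/-- A cubic arc-transitive multigraph has no loops. -/
lemma not_isLink_self_of_isCubic (hcubic : X.IsCubic) (harc : X.IsArcTransitive) (e : β) (x : α) :
    ¬ X.IsLink e x x := by
  intro h
  -- If all edges at `x` are loops, the degree is twice their number. Otherwise an automorphism
  -- would map the loop, as an arc with equal ends, to an arc with distinct ends.
  by_cases hall : X.incidenceSet x ⊆ X.loopSet x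
  · have h3 := hcubic x h.left_mem
    rw [vertexDegree, hall.antisymm (X.loopSet_subset_incidenceSet x)] at h3
    cases hn : (X.loopSet x).encard with
    | top => simp [hn] at h3
    | coe n =>
      rw [hn] at h3
      norm_cast at h3
      omega
  · obtain ⟨e', ⟨y, hy⟩, he'⟩ := Set.not_subset.1 hall
    obtain ⟨φ, -, h1, h2⟩ := harc h hy
    have : x = y := congrArg Subtype.val (h1.symm.trans h2)
    subst this
    exact he' hy

/-- Around a vertex of a loopless cubic multigraph. -/
lemma exists_three_isLink (hcubic : X.IsCubic) (hloop : ∀ e x, ¬ X.IsLink e x x) {x : α}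
    (hx : x ∈ V(X)) : ∃ e f g a b c, e ≠ f ∧ e ≠ g ∧ f ≠ g ∧ X.IsLink e x a ∧ X.IsLink f x b ∧
      X.IsLink g x c ∧ ∀ h y, X.IsLink h x y → h = e ∨ h = f ∨ h = g := by
  have h3 := hcubic x hx
  have hl : X.loopSet x = ∅ := Set.eq_empty_of_forall_notMem fun e => hloop e x
  rw [vertexDegree, hl, Set.encard_empty, add_zero, Set.encard_eq_three] at h3
  obtain ⟨e, f, g, hef, heg, hfg, h⟩ := h3
  have mem : ∀ k, X.Inc k x ↔ k = e ∨ k = f ∨ k = g := fun k => by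
    rw [← mem_incidenceSet, h]; rfl
  obtain ⟨a, ha⟩ := (mem e).2 (by simp)
  obtain ⟨b, hb⟩ := (mem f).2 (by simp)
  obtain ⟨c, hc⟩ := (mem g).2 (by simp)
  exact ⟨e, f, g, a, b, c, hef, heg, hfg, ha, hb, hc, fun k y hk => (mem k).1 ⟨y, hk⟩⟩

/-- A connected cubic arc-transitive multigraph with two parallel edges is the theta graph. -/
lemma isIsomorphic_theta (hconn : X.IsConnected) (hcubic : X.IsCubic) (harc : X.IsArcTransitive)
    {e e' : β} {x y : α} (he : X.IsLink e x y) (he' : X.IsLink e' x y) (hne : e ≠ e') :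
    X.IsIsomorphic theta := by
  have hloop := not_isLink_self_of_isCubic hcubic harc
  have hpar : ∀ f u w, X.IsLink f u w → ∃ f', f' ≠ f ∧ X.IsLink f' u w := by
    intro f u w hf
    obtain ⟨φ, h1, h2, h3⟩ := harc he hf
    refine ⟨φ.edgeEquiv ⟨e', he'.edge_mem⟩, fun h => hne ?_, ?_⟩
    · have := φ.edgeEquiv.injective ((Subtype.ext h).trans h1.symm)
      exact (congrArg Subtype.val this).symm
    · have := (φ.isLink_iff ⟨e', he'.edge_mem⟩ ⟨x, he.left_mem⟩ ⟨y, he.right_mem⟩).2 he'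
      rwa [h2, h3] at this
  have hpar3 : ∀ u ∈ V(X), ∃ e f g w, e ≠ f ∧ e ≠ g ∧ f ≠ g ∧ X.IsLink e u w ∧ X.IsLink f u w ∧
      X.IsLink g u w ∧ ∀ h z, X.IsLink h u z → h = e ∨ h = f ∨ h = g := by
    intro u hu
    obtain ⟨e, f, g, a, b, c, hef, heg, hfg, ha, hb, hc, h⟩ := exists_three_isLink hcubic hloop hu
    -- Each of the three edges at `u` is parallel to another of them, and a partition of three edges
    -- without singletons has a single class.
    have key : a = b ∧ a = c := by
      obtain ⟨e₁, h1, h1'⟩ := hpar _ _ _ ha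
      obtain ⟨f₁, h2, h2'⟩ := hpar _ _ _ hb
      obtain ⟨g₁, h3, h3'⟩ := hpar _ _ _ hc
      have k1 := h _ _ h1'
      have k2 := h _ _ h2'
      have k3 := h _ _ h3'
      have r : ∀ {k p q}, X.IsLink k u p → X.IsLink k u q → p = q := fun h h' => h.right_unique h'
      grind
    obtain ⟨rfl, rfl⟩ := key
    exact ⟨e, f, g, a, hef, heg, hfg, ha, hb, hc, h⟩
  obtain ⟨e₁, e₂, e₃, y', h12, h13, h23, l1, l2, l3, hx⟩ := hpar3 x he.left_mem
  obtain rfl : y = y' := by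
    rcases hx _ _ he with rfl | rfl | rfl
    exacts [he.right_unique l1, he.right_unique l2, he.right_unique l3]
  obtain ⟨f₁, f₂, f₃, x', g12, g13, g23, m1, m2, m3, hy⟩ := hpar3 y he.right_mem
  have hyl : ∀ h z, X.IsLink h y z → h = e₁ ∨ h = e₂ ∨ h = e₃ := by
    have k1 := hy _ _ l1.symm
    have k2 := hy _ _ l2.symm
    have k3 := hy _ _ l3.symm
    intro h z hz
    have := hy _ _ hz
    grind
  have hxy : x ≠ y := fun h => hloop e x (by rwa [← h] at he)
  have hlink : ∀ k : Fin 3, X.IsLink (![e₁, e₂, e₃] k) x y := by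
    intro k
    fin_cases k
    exacts [l1, l2, l3]
  have hV : ∀ z ∈ V(X), z = x ∨ z = y := by
    intro z hz
    induction hconn.2 x he.left_mem z hz with
    | refl => exact .inl rfl
    | @tail b c _ hbc ih =>
      obtain ⟨k, hk⟩ := hbc
      have : k = e₁ ∨ k = e₂ ∨ k = e₃ := by
        rcases ih hk.left_mem with rfl | rfl
        exacts [hx _ _ hk, hyl _ _ hk]
      rcases this with rfl | rfl | rfl
      exacts [hk.right_eq_or_eq l1, hk.right_eq_or_eq l2, hk.right_eq_or_eq l3]
  have hE : ∀ k ∈ E(X), k = e₁ ∨ k = e₂ ∨ k = e₃ := by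
    intro k hk
    obtain ⟨u, w, hk⟩ := X.exists_isLink_of_mem_edgeSet hk
    rcases hV u hk.left_mem with rfl | rfl
    exacts [hx _ _ hk, hyl _ _ hk]
  have hv : ∀ i : Fin 2, ![x, y] i ∈ V(X) := by
    intro i
    fin_cases i
    exacts [he.left_mem, he.right_mem]
  have hvbij : Function.Bijective fun i : V(theta) => (⟨![x, y] i.1, hv _⟩ : V(X)) := by
    constructor
    · rintro ⟨i, hi⟩ ⟨j, hj⟩ h
      have h' : ![x, y] i = ![x, y] j := congrArg Subtype.val h
      apply Subtype.ext
      change i = j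
      fin_cases i <;> fin_cases j <;> first | rfl | exact absurd h' hxy | exact absurd h'.symm hxy
    · rintro ⟨z, hz⟩
      rcases hV z hz with rfl | rfl
      exacts [⟨⟨0, by simp [theta]⟩, rfl⟩, ⟨⟨1, by simp [theta]⟩, rfl⟩]
  have hebij : Function.Bijective fun i : E(theta) =>
      (⟨![e₁, e₂, e₃] i.1, (hlink _).edge_mem⟩ : E(X)) := by
    constructor
    · rintro ⟨i, hi⟩ ⟨j, hj⟩ h
      exact Subtype.ext (SimpleGraph.injective_vecCons_three h12 h13 h23 (congrArg Subtype.val h))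
    · rintro ⟨z, hz⟩
      rcases hE z hz with rfl | rfl | rfl
      exacts [⟨⟨0, by simp [theta]⟩, rfl⟩, ⟨⟨1, by simp [theta]⟩, rfl⟩, ⟨⟨2, by simp [theta]⟩, rfl⟩]
  refine ⟨Iso.symm ⟨Equiv.ofBijective _ hvbij, Equiv.ofBijective _ hebij, ?_⟩⟩
  rintro ⟨k, hk⟩ ⟨i, hi⟩ ⟨j, hj⟩
  change X.IsLink (![e₁, e₂, e₃] k) (![x, y] i) (![x, y] j) ↔ theta.IsLink k i j
  rw [(hlink k).isLink_iff]
  simp only [theta, banana_isLink, Set.mem_univ, true_and]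
  have := hxy.symm
  fin_cases i <;> fin_cases j <;> simp_all

/-- The simple graph on the vertices of a loopless multigraph. -/
def loopless (X : Graph α β) (hloop : ∀ e x, ¬ X.IsLink e x x) : SimpleGraph V(X) where
  Adj x y := X.Adj x y
  symm := ⟨fun _ _ h => h.symm⟩
  loopless := ⟨fun _ ⟨e, h⟩ => hloop e _ h⟩

/-- Without parallel edges the three edges at a vertex lead to three distinct neighbours, and every
multigraph automorphism induces one of the simple graph by forgetting its action on edges. -/
lemma isCubicSymmetric_loopless (hconn : X.IsConnected) (hcubic : X.IsCubic)
    (harc : X.IsArcTransitive) (hloop : ∀ e x, ¬ X.IsLink e x x)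
    (hpar : ∀ e f x y, X.IsLink e x y → X.IsLink f x y → e = f) :
    (X.loopless hloop).IsCubicSymmetric where
  reachable := by
    rintro ⟨x, hx⟩ ⟨y, hy⟩
    induction hconn.2 x hx y hy with
    | refl => exact .refl
    | tail _ h ih => exact (ih h.left_mem).tail h
  cubic := by
    rintro ⟨x, hx⟩
    obtain ⟨e, f, g, a, b, c, hef, heg, hfg, ha, hb, hc, h⟩ := exists_three_isLink hcubic hloop hx
    refine ⟨⟨a, ha.right_mem⟩, ⟨b, hb.right_mem⟩, ⟨c, hc.right_mem⟩, ?_, ?_, ?_, ?_⟩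
    · intro hab
      obtain rfl : a = b := congrArg Subtype.val hab
      exact hef (hpar _ _ _ _ ha hb)
    · intro hab
      obtain rfl : a = c := congrArg Subtype.val hab
      exact heg (hpar _ _ _ _ ha hc)
    · intro hab
      obtain rfl : b = c := congrArg Subtype.val hab
      exact hfg (hpar _ _ _ _ hb hc)
    · rintro ⟨y, hy⟩
      simp only [Subtype.mk.injEq]
      constructor
      · rintro ⟨k, hk⟩
        rcases h k y hk with rfl | rfl | rfl
        exacts [.inl (hk.right_unique ha), .inr (.inl (hk.right_unique hb)),
          .inr (.inr (hk.right_unique hc))]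
      · rintro (rfl | rfl | rfl)
        exacts [⟨e, ha⟩, ⟨f, hb⟩, ⟨g, hc⟩]
  arcTransitive := by
    rintro ⟨x, hx⟩ ⟨y, hy⟩ ⟨x', hx'⟩ ⟨y', hy'⟩ ⟨e, he⟩ ⟨e', he'⟩
    obtain ⟨φ, -, h1, h2⟩ := harc he he'
    refine ⟨⟨φ.vertexEquiv, ?_⟩, h1, h2⟩
    intro a b
    constructor
    · rintro ⟨k, hk⟩
      obtain ⟨l, hl⟩ := φ.edgeEquiv.surjective ⟨k, hk.edge_mem⟩
      refine ⟨l, (φ.isLink_iff l a b).1 ?_⟩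
      rw [hl]
      exact hk
    · rintro ⟨k, hk⟩
      exact ⟨_, (φ.isLink_iff ⟨k, hk.edge_mem⟩ a b).2 hk⟩

/-- A multigraph without loops and parallel edges is determined by its adjacency relation. -/
lemma isIsomorphic_ofSimpleGraph (hloop : ∀ e x, ¬ X.IsLink e x x)
    (hpar : ∀ e f x y, X.IsLink e x y → X.IsLink f x y → e = f) {W : Type*} {H : SimpleGraph W}
    (h : Nonempty (H ≃g X.loopless hloop)) : X.IsIsomorphic (ofSimpleGraph H) := by
  obtain ⟨ψ⟩ := h
  -- Each edge is sent to the pair of its ends, transported to `H`. Injectivity of this map is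
  -- exactly the absence of parallel edges.
  have hF : ∀ e : E(X), ∃ s : H.edgeSet, ∀ x y : V(X), s.1 = s(ψ.symm x, ψ.symm y) ↔
      X.IsLink e x y := by
    rintro ⟨e, he⟩
    obtain ⟨x, y, hxy⟩ := X.exists_isLink_of_mem_edgeSet he
    refine ⟨⟨s(ψ.symm ⟨x, hxy.left_mem⟩, ψ.symm ⟨y, hxy.right_mem⟩), ?_⟩, ?_⟩
    · rw [SimpleGraph.mem_edgeSet, ψ.symm.map_adj_iff]
      exact ⟨e, hxy⟩
    · rintro ⟨u, hu⟩ ⟨w, hw⟩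
      rw [hxy.isLink_iff_sym2_eq]
      simp
  choose F hF using hF
  have hbij : Function.Bijective F := by
    constructor
    · intro e f hef
      obtain ⟨x, y, hxy⟩ := X.exists_isLink_of_mem_edgeSet e.2
      have := (hF e ⟨x, hxy.left_mem⟩ ⟨y, hxy.right_mem⟩).2 hxy
      rw [hef] at this
      exact Subtype.ext (hpar _ _ _ _ hxy ((hF f _ _).1 this))
    · rintro ⟨s, hs⟩
      induction s with
      | h a b =>
        obtain ⟨k, hk⟩ := ψ.map_adj_iff.2 (SimpleGraph.mem_edgeSet _ |>.1 hs)
        refine ⟨⟨k, hk.edge_mem⟩, Subtype.ext ?_⟩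
        simpa using (hF ⟨k, hk.edge_mem⟩ (ψ a) (ψ b)).2 hk
  refine ⟨⟨ψ.symm.toEquiv.trans (Equiv.Set.univ W).symm, Equiv.ofBijective F hbij, ?_⟩⟩
  intro e x y
  rw [← hF e x y]
  exact ⟨fun h => h.1, fun h => ⟨h, (F e).2⟩⟩

end Graph

/-! ### The theorem for multigraphs -/

theorem proposition3p4 {α β : Type*} (X : Graph α β) (hconn : X.IsConnected)
    (hcubic : X.IsCubic) (harc : X.IsArcTransitive) :
    6 ≤ X.girth ∨
      (X.IsIsomorphic Graph.theta ∨
        X.IsIsomorphic (Graph.ofSimpleGraph (⊤ : SimpleGraph (Fin 4))) ∨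
        X.IsIsomorphic (Graph.ofSimpleGraph (completeBipartiteGraph (Fin 3) (Fin 3))) ∨
        X.IsIsomorphic (Graph.ofSimpleGraph cubeGraph) ∨
        X.IsIsomorphic (Graph.ofSimpleGraph (generalizedPetersen 5 2)) ∨
        X.IsIsomorphic (Graph.ofSimpleGraph (generalizedPetersen 10 2))) := by
  refine or_iff_not_imp_left.2 fun hgirth => or_iff_not_imp_left.2 fun htheta => ?_
  have hloop := Graph.not_isLink_self_of_isCubic hcubic harc
  have hpar : ∀ e f x y, X.IsLink e x y → X.IsLink f x y → e = f := by
    intro e f x y he hf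
    by_contra hne
    exact htheta (Graph.isIsomorphic_theta hconn hcubic harc he hf hne)
  have hG := Graph.isCubicSymmetric_loopless hconn hcubic harc hloop hpar
  have hcycle : ∃ n < 6, X.HasCycleOfLength n := by
    by_contra! h
    refine hgirth (le_iInf₂ fun n hn => ?_)
    by_contra hlt
    exact h n (by exact_mod_cast not_le.1 hlt) hn
  obtain ⟨n, hn, h1, v, e, hlink, hv0, hv, he⟩ := hcycle
  have mem : ∀ i < n, v i ∈ V(X) := fun i hi => (hlink i hi).left_mem
  have hne : ∀ i j, i < n → j < n → i ≠ j → v i ≠ v j := fun i j hi hj hij h => hij (hv hi hj h)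
  have main := hG.classification (by
    -- Length `1` is a loop and length `2` a pair of parallel edges, both already excluded; the
    -- other lengths are the three cases of `classification`.
    obtain rfl | rfl | rfl | rfl | rfl : n = 1 ∨ n = 2 ∨ n = 3 ∨ n = 4 ∨ n = 5 := by omega
    · have := hlink 0 (by omega)
      rw [hv0] at this
      exact absurd this (hloop _ _)
    · have h0 := hlink 0 (by omega)
      have h1 := hlink 1 (by omega)
      rw [hv0] at h1
      exact absurd (he (by simp) (by simp) (hpar _ _ _ _ h0 h1.symm)) zero_ne_one
    · have h2 := hlink 2 (by omega)
      rw [hv0] at h2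
      exact .inl ⟨⟨_, mem 0 (by omega)⟩, ⟨_, mem 1 (by omega)⟩, ⟨_, mem 2 (by omega)⟩,
        ⟨_, hlink 0 (by omega)⟩, ⟨_, hlink 1 (by omega)⟩, ⟨_, h2.symm⟩⟩
    · have h3 := hlink 3 (by omega)
      rw [hv0] at h3
      exact .inr (.inl ⟨⟨_, mem 0 (by omega)⟩, ⟨_, mem 1 (by omega)⟩, ⟨_, mem 2 (by omega)⟩,
        ⟨_, mem 3 (by omega)⟩, ⟨_, hlink 0 (by omega)⟩, ⟨_, hlink 1 (by omega)⟩,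
        ⟨_, hlink 2 (by omega)⟩, ⟨_, h3⟩,
        fun h => hne 0 2 (by omega) (by omega) (by omega) (congrArg Subtype.val h),
        fun h => hne 1 3 (by omega) (by omega) (by omega) (congrArg Subtype.val h)⟩)
    · have h4 := hlink 4 (by omega)
      rw [hv0] at h4
      -- `ZMod 5` unfolds to `Fin 5`, whose addition wraps around, so the edge from `v 4` back to `v
      -- 0` is the case `i = 4`.
      refine .inr (.inr ⟨fun i : Fin 5 => ⟨v i.val, mem _ i.isLt⟩, fun i : Fin 5 => ?_⟩)
      fin_cases i
      exacts [⟨_, hlink 0 (by omega)⟩, ⟨_, hlink 1 (by omega)⟩, ⟨_, hlink 2 (by omega)⟩,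
        ⟨_, hlink 3 (by omega)⟩, ⟨_, h4⟩])
  have toIso := fun {W : Type} {H : SimpleGraph W} =>
    Graph.isIsomorphic_ofSimpleGraph (H := H) hloop hpar
  exact main.imp toIso (.imp toIso (.imp toIso (.imp toIso toIso)))
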